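/- Let $\mathbb{D}=\{|z|<1\}$ and let $\mathcal{N}$ (the Nehari class) be the set of analytic, locally univalent functions $f$ on $\mathbb{D}$ with $f(0)=0$, $f'(0)=1$ and $(1-|z|^2)^2|Sf(z)|\le 2$ for all $z\in\mathbb{D}$, where $Sf=(f''/f')'-\tfrac12(f''/f')^2$ is the Schwarzian derivative. For $f\in\mathcal{N}$ let $a_2=a_2(f)=f''(0)/2$ and $f^*=f/(1+a_2f)$, and put $$\delta_f=\inf_{z\in\mathbb{D}}\left|f(z)+\frac1{a_2}\right|\quad\text{if } a_2\ne 0,\qquad \delta_f=\inf_{z\in\mathbb{D}} d(f(z),\infty)\quad\text{if } a_2=0,$$ where $d(w,\infty)=\pi-2\arctan|w|$ is the spherical distance from $w$ to $\infty$. Let $(f_n)$ be a sequence in $\mathcal{N}$ with $\delta_{f_n}\to 0$. Then there are a subsequence $(f_{n_k})$ and a constant $c$ with $|c|=1$ such that $f_{n_k}^*$ converges locally uniformly on $\mathbb{D}$ to the rotation $z\mapsto c^{-1}L(cz)$ of the strip map $L(z)=\tfrac12\log\frac{1+z}{1-z}$ (principal branch). -/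

import Mathlib

open Filter Topology

noncomputable section

namespace Nehari

/-- The Schwarzian derivative `Sf = (f''/f')' - (1/2) (f''/f')^2`. -/
def schwarzian (f : ℂ → ℂ) (z : ℂ) : ℂ :=
  deriv (fun w => deriv (deriv f) w / deriv f w) z
    - (1 / 2) * (deriv (deriv f) z / deriv f z) ^ 2

/-- The Nehari class: analytic, locally univalent functions `f` of the open unit disk with
`f 0 = 0`, `f' 0 = 1` and `(1 - |z|^2)^2 |Sf(z)| ≤ 2`. Only the values of `f` on the disk matter.
For an analytic function, local univalence is the same as a non-vanishing derivative. -/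
structure NehariClass (f : ℂ → ℂ) : Prop where
  differentiableOn : DifferentiableOn ℂ f (Metric.ball 0 1)
  deriv_ne_zero : ∀ z ∈ Metric.ball (0 : ℂ) 1, deriv f z ≠ 0
  map_zero : f 0 = 0
  deriv_zero : deriv f 0 = 1
  schwarzian_le : ∀ z ∈ Metric.ball (0 : ℂ) 1, (1 - ‖z‖ ^ 2) ^ 2 * ‖schwarzian f z‖ ≤ 2

/-- The second Taylor coefficient `a₂ = f''(0) / 2` at the origin. -/
def a₂ (f : ℂ → ℂ) : ℂ := deriv (deriv f) 0 / 2

/-- The normalized map `f* = f / (1 + a₂ f)`. -/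
def normalized (f : ℂ → ℂ) (z : ℂ) : ℂ := f z / (1 + a₂ f * f z)

/-- The spherical (great-circle) distance on the unit sphere from the stereographic image
of `w` to the point at infinity. -/
def sphericalDistInfty (w : ℂ) : ℝ := Real.pi - 2 * Real.arctan ‖w‖

open Classical in
/-- `δ_f = inf_{|z| < 1} |f z + 1 / a₂|` if `a₂ ≠ 0`; if `a₂ = 0`, so that `-1 / a₂` is the point
at infinity, the distance is the spherical one. -/
def delta (f : ℂ → ℂ) : ℝ :=
  if a₂ f = 0 then ⨅ z : Metric.ball (0 : ℂ) 1, sphericalDistInfty (f z)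
  else ⨅ z : Metric.ball (0 : ℂ) 1, ‖f z + 1 / a₂ f‖

/-- The parallel strip map `L z = (1/2) log ((1 + z) / (1 - z))`, with the principal logarithm
(for `|z| < 1` the quotient has positive real part). -/
def stripMap (z : ℂ) : ℂ := (1 / 2) * Complex.log ((1 + z) / (1 - z))

end Nehari

end

/-! Put `w = (f')^{-1/2} (1 + a₂ f)`. Then `w'' + (Sf/2) w = 0`, `w(0) = 1`, `w'(0) = 0` and `(f*)'
= 1/w²`. On the ray `z = e tanh s` set `H(s) = cosh s · w(z)`. The Nehari bound becomes `|H'' - H| ≤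
|H|`, so `H''` never points towards the origin: `|H|` is convex, at least 1, and flat at `s = 0`.
Since `d/ds f*(e tanh s) = e/H²`, `|f*| ≤ s` always, and `f*` is bounded on the whole ray once `|H|`
exceeds 1.

The coefficients `a₂` are uniformly bounded and `f + 1/a₂ = 1/(a₂ (1 - a₂ f*))`, so `δ → 0` forces
`sup |f_n*| → ∞`, attained along directions `e_n`. By normality a subsequence has `w_n → w₀` and
`e_n → e₀`. On the ray of `e₀` one has `|H| ≡ 1`, as otherwise the `f_n*` would be bounded on the
rays of `e_n`. Hence `H ≡ 1`, that is `w₀ = 1/cosh s` on this ray, so `w₀² = 1 - (z/e₀)²` on the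
disk; integrating `1/w₀²` gives the rotated strip map. -/

/-! ### Curves repelled from the origin -/

section Ray

variable {E : Type*} [NormedAddCommGroup E] [InnerProductSpace ℝ E]

/-- A twice differentiable curve with unit initial position, zero initial velocity, and
acceleration never pointing towards the origin. -/
structure RepelledCurve (H H₁ H₂ : ℝ → E) : Prop where
  hasDerivAt : ∀ s, HasDerivAt H (H₁ s) s
  hasDerivAt_velocity : ∀ s, HasDerivAt H₁ (H₂ s) s
  norm_initial : ‖H 0‖ = 1
  velocity_zero : H₁ 0 = 0
  inner_nonneg : ∀ s, 0 ≤ inner ℝ (H s) (H₂ s)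

namespace RepelledCurve

variable {H H₁ H₂ : ℝ → E} (h : RepelledCurve H H₁ H₂)

include h

theorem hasDerivAt_inner (s : ℝ) :
    HasDerivAt (fun s => inner ℝ (H s) (H₁ s)) (inner ℝ (H s) (H₂ s) + ‖H₁ s‖ ^ 2) s := by
  have := (h.hasDerivAt s).inner ℝ (h.hasDerivAt_velocity s)
  rwa [real_inner_self_eq_norm_sq] at this

theorem inner_velocity_nonneg {s : ℝ} (hs : 0 ≤ s) : 0 ≤ inner ℝ (H s) (H₁ s) := by
  have hm : Monotone fun s => inner ℝ (H s) (H₁ s) :=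
    monotone_of_hasDerivAt_nonneg h.hasDerivAt_inner
      fun s => add_nonneg (h.inner_nonneg s) (sq_nonneg _)
  simpa [h.velocity_zero] using hm hs

theorem one_le_norm {s : ℝ} (hs : 0 ≤ s) : 1 ≤ ‖H s‖ := by
  have hd : ∀ s, HasDerivAt (fun s => ‖H s‖ ^ 2) (2 * inner ℝ (H s) (H₁ s)) s :=
    fun s => (h.hasDerivAt s).norm_sq
  have hm : MonotoneOn (fun s => ‖H s‖ ^ 2) (Set.Ici 0) := by
    refine monotoneOn_of_hasDerivWithinAt_nonneg (convex_Ici 0)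
      (fun s _ => (hd s).continuousAt.continuousWithinAt)
      (fun s _ => (hd s).hasDerivWithinAt) fun s hs => ?_
    have := h.inner_velocity_nonneg (interior_subset hs)
    positivity
  have := hm Set.self_mem_Ici hs hs
  simp only [h.norm_initial] at this
  nlinarith [norm_nonneg (H s)]

theorem hasDerivAt_norm {s : ℝ} (hs : 0 ≤ s) :
    HasDerivAt (fun s => ‖H s‖) (inner ℝ (H s) (H₁ s) / ‖H s‖) s := by
  have h0 : (‖H s‖ ^ 2) ≠ 0 := by have := h.one_le_norm hs; positivity
  have := ((h.hasDerivAt s).norm_sq).sqrt h0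
  simp only [Real.sqrt_sq (norm_nonneg _)] at this
  convert this using 1
  rw [mul_div_mul_left _ _ two_ne_zero]

/-- The norm is differentiable because it stays at least 1. Its second derivative is nonnegative by
Cauchy–Schwarz together with `inner_nonneg`. -/
theorem convexOn_norm : ConvexOn ℝ (Set.Ici 0) fun s => ‖H s‖ := by
  refine convexOn_of_hasDerivWithinAt2_nonneg (convex_Ici 0)
    (f' := fun s => inner ℝ (H s) (H₁ s) / ‖H s‖)
    (f'' := fun s => ((inner ℝ (H s) (H₂ s) + ‖H₁ s‖ ^ 2) * ‖H s‖
      - inner ℝ (H s) (H₁ s) * (inner ℝ (H s) (H₁ s) / ‖H s‖)) / ‖H s‖ ^ 2)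
    (fun s hs => (h.hasDerivAt_norm hs).continuousAt.continuousWithinAt)
    (fun s hs => (h.hasDerivAt_norm (interior_subset hs)).hasDerivWithinAt)
    (fun s hs => ?_) fun s hs => ?_
  all_goals have hpos : 0 < ‖H s‖ := one_pos.trans_le (h.one_le_norm (interior_subset hs))
  · exact ((h.hasDerivAt_inner s).div (h.hasDerivAt_norm (interior_subset hs))
      hpos.ne').hasDerivWithinAt
  · refine div_nonneg ?_ (sq_nonneg _)
    have hcs : inner ℝ (H s) (H₁ s) ^ 2 ≤ ‖H s‖ ^ 2 * ‖H₁ s‖ ^ 2 := by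
      rw [← mul_pow, sq_le_sq, abs_of_nonneg (by positivity : 0 ≤ ‖H s‖ * ‖H₁ s‖)]
      exact abs_real_inner_le_norm _ _
    rw [sub_nonneg, ← mul_div_assoc, div_le_iff₀ hpos]
    nlinarith [mul_nonneg (h.inner_nonneg s) (sq_nonneg ‖H s‖)]

theorem linear_growth {α s₀ s : ℝ} (hs₀ : 0 < s₀) (hα : 1 + α * s₀ ≤ ‖H s₀‖) (hs : s₀ ≤ s) :
    1 + α * s ≤ ‖H s‖ := by
  have hspos : 0 < s := hs₀.trans_le hs
  have := h.convexOn_norm.2 Set.self_mem_Ici (Set.mem_Ici.2 hspos.le)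
    (sub_nonneg.2 ((div_le_one hspos).2 hs)) (by positivity : 0 ≤ s₀ / s) (by ring)
  simp only [smul_eq_mul, mul_zero, zero_add, div_mul_cancel₀ _ hspos.ne', h.norm_initial,
    mul_one] at this
  have h2 : s₀ / s * (1 + α * s) ≤ s₀ / s * ‖H s‖ := by
    calc s₀ / s * (1 + α * s) = s₀ / s + α * s₀ := by field_simp
      _ ≤ _ := by linarith
  exact le_of_mul_le_mul_left h2 (by positivity)

/-- Constant norm gives `⟨H, H'⟩ = 0`. Differentiating again, `⟨H, H''⟩ + |H'|² = 0` with both terms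
nonnegative, so `H' = 0`. -/
theorem eq_of_norm_eq_one (h1 : ∀ s, 0 < s → ‖H s‖ = 1) {s : ℝ} (hs : 0 ≤ s) : H s = H 0 := by
  have hin : ∀ s, 0 < s → inner ℝ (H s) (H₁ s) = 0 := by
    intro s hs
    have hd : HasDerivAt (fun s => ‖H s‖ ^ 2) (2 * inner ℝ (H s) (H₁ s)) s :=
      (h.hasDerivAt s).norm_sq
    have hc : HasDerivAt (fun s => ‖H s‖ ^ 2) 0 s := by
      refine (hasDerivAt_const s (1 : ℝ)).congr_of_eventuallyEq ?_
      filter_upwards [lt_mem_nhds hs] with t ht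
      simp [h1 t ht]
    simpa using hd.unique hc
  have hv : ∀ s, 0 < s → H₁ s = 0 := by
    intro s hs
    have hc : HasDerivAt (fun s => inner ℝ (H s) (H₁ s)) 0 s := by
      refine (hasDerivAt_const s (0 : ℝ)).congr_of_eventuallyEq ?_
      filter_upwards [lt_mem_nhds hs] with t ht
      exact hin t ht
    have := (h.hasDerivAt_inner s).unique hc
    have h2 : ‖H₁ s‖ ^ 2 = 0 := by nlinarith [h.inner_nonneg s, sq_nonneg ‖H₁ s‖]
    simpa using h2
  have hv' : ∀ s, 0 ≤ s → H₁ s = 0 := fun s hs =>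
    hs.eq_or_lt.elim (fun h0 => h0 ▸ h.velocity_zero) (hv s)
  exact constant_of_has_deriv_right_zero (a := 0) (b := s)
    (fun t _ => (h.hasDerivAt t).continuousAt.continuousWithinAt)
    (fun t ht => by simpa [hv' t ht.1] using (h.hasDerivAt t).hasDerivWithinAt) s ⟨hs, le_rfl⟩

/-- Grönwall for the energy `|H|² + |H'|²`, whose derivative is at most `6 |H| |H'|`. This supplies
the local bound needed for normality. -/
theorem norm_sq_le_exp (h2 : ∀ s, ‖H₂ s‖ ≤ 2 * ‖H s‖) {s : ℝ} (hs : 0 ≤ s) :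
    ‖H s‖ ^ 2 ≤ Real.exp (3 * s) := by
  have hd : ∀ s, HasDerivAt (fun s => (‖H s‖ ^ 2 + ‖H₁ s‖ ^ 2) * Real.exp (-3 * s))
      ((2 * inner ℝ (H s) (H₁ s) + 2 * inner ℝ (H₁ s) (H₂ s)) * Real.exp (-3 * s)
        + (‖H s‖ ^ 2 + ‖H₁ s‖ ^ 2) * (Real.exp (-3 * s) * (-3 * 1))) s := fun s =>
    ((h.hasDerivAt s).norm_sq.add (h.hasDerivAt_velocity s).norm_sq).mul
      (((hasDerivAt_id s).const_mul (-3)).exp)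
  have hm : Antitone fun s => (‖H s‖ ^ 2 + ‖H₁ s‖ ^ 2) * Real.exp (-3 * s) := by
    refine antitone_of_hasDerivAt_nonpos hd fun s => ?_
    have e := Real.exp_pos (-3 * s)
    have i1 : inner ℝ (H s) (H₁ s) ≤ ‖H s‖ * ‖H₁ s‖ := real_inner_le_norm _ _
    have i2 : inner ℝ (H₁ s) (H₂ s) ≤ ‖H₁ s‖ * (2 * ‖H s‖) :=
      (real_inner_le_norm _ _).trans (mul_le_mul_of_nonneg_left (h2 s) (norm_nonneg _))
    have : 2 * inner ℝ (H s) (H₁ s) + 2 * inner ℝ (H₁ s) (H₂ s)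
        - 3 * (‖H s‖ ^ 2 + ‖H₁ s‖ ^ 2) ≤ 0 := by nlinarith [sq_nonneg (‖H s‖ - ‖H₁ s‖)]
    calc _ = (2 * inner ℝ (H s) (H₁ s) + 2 * inner ℝ (H₁ s) (H₂ s)
        - 3 * (‖H s‖ ^ 2 + ‖H₁ s‖ ^ 2)) * Real.exp (-3 * s) := by ring
      _ ≤ 0 := mul_nonpos_of_nonpos_of_nonneg this e.le
  have := hm hs
  simp only [h.norm_initial, h.velocity_zero, norm_zero, mul_zero, Real.exp_zero, neg_mul,
    Real.exp_neg] at this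
  rw [← div_eq_mul_inv, div_le_iff₀ (Real.exp_pos _)] at this
  nlinarith [sq_nonneg ‖H₁ s‖]

end RepelledCurve

end Ray

/-! ### Solutions on the disk along hyperbolic rays -/

namespace Real

theorem hasDerivAt_tanh (s : ℝ) : HasDerivAt tanh (1 / cosh s ^ 2) s := by
  have h := (hasDerivAt_sinh s).div (hasDerivAt_cosh s) (cosh_pos s).ne'
  have he : tanh = fun s => sinh s / cosh s := funext tanh_eq_sinh_div_cosh
  rw [he]
  refine h.congr_deriv ?_
  rw [← cosh_sq_sub_sinh_sq s]
  ring

theorem one_sub_tanh_sq (s : ℝ) : 1 - tanh s ^ 2 = 1 / cosh s ^ 2 := by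
  have := (cosh_pos s).ne'
  rw [tanh_eq_sinh_div_cosh]
  field_simp
  exact cosh_sq_sub_sinh_sq s

end Real

namespace Nehari

/-- The unit disk in polar form: a point of modulus `tanh s` in the direction `e`. -/
noncomputable def polar (e : ℂ) (s : ℝ) : ℂ := (Real.tanh s : ℂ) * e

theorem norm_polar {e : ℂ} (he : ‖e‖ = 1) (s : ℝ) : ‖polar e s‖ = |Real.tanh s| := by
  rw [polar, norm_mul, he, mul_one, Complex.norm_real, Real.norm_eq_abs]

theorem polar_mem {e : ℂ} (he : ‖e‖ = 1) (s : ℝ) : polar e s ∈ Metric.ball (0 : ℂ) 1 := by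
  rw [mem_ball_zero_iff, norm_polar he]
  exact Real.abs_tanh_lt_one s

@[simp] theorem polar_zero (e : ℂ) : polar e 0 = 0 := by simp [polar]

theorem exists_eq_polar {z : ℂ} (hz : z ∈ Metric.ball (0 : ℂ) 1) :
    ∃ e : ℂ, ‖e‖ = 1 ∧ z = polar e (Real.artanh ‖z‖) := by
  have hz' : ‖z‖ ∈ Set.Ioo (-1 : ℝ) 1 :=
    ⟨by linarith [norm_nonneg z], mem_ball_zero_iff.1 hz⟩
  simp only [polar, Real.tanh_artanh hz']
  by_cases h : z = 0
  · exact ⟨1, by simp [h]⟩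
  · have hn : ‖z‖ ≠ 0 := norm_ne_zero_iff.2 h
    exact ⟨z / ‖z‖, by simp [hn], by rw [mul_div_cancel₀]; exact_mod_cast hn⟩

theorem hasDerivAt_polar (e : ℂ) (s : ℝ) :
    HasDerivAt (polar e) (((1 / Real.cosh s ^ 2 : ℝ) : ℂ) * e) s :=
  (Real.hasDerivAt_tanh s).ofReal_comp.mul_const e

/-- Solutions `w` of `w'' + p w = 0`, `w 0 = 1`, `w' 0 = 0` on the unit disk with
`(1 - |z|^2)^2 |p z| ≤ 1`. -/
structure DiskSolution (w : ℂ → ℂ) : Prop where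
  differentiableOn : DifferentiableOn ℂ w (Metric.ball 0 1)
  map_zero : w 0 = 1
  deriv_zero : deriv w 0 = 0
  deriv_deriv_le : ∀ z ∈ Metric.ball (0 : ℂ) 1, (1 - ‖z‖ ^ 2) ^ 2 * ‖deriv (deriv w) z‖ ≤ ‖w z‖

/-- A solution on a ray, in hyperbolic arc length and relative to the extremal solution
`1 / cosh s`. -/
noncomputable def rayCurve (w : ℂ → ℂ) (e : ℂ) (s : ℝ) : ℂ := (Real.cosh s : ℂ) * w (polar e s)

/-- The derivative of `rayCurve`. -/
noncomputable def rayVelocity (w : ℂ → ℂ) (e : ℂ) (s : ℝ) : ℂ :=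
  (Real.sinh s : ℂ) * w (polar e s) + ((1 / Real.cosh s : ℝ) : ℂ) * (e * deriv w (polar e s))

/-- The second derivative of `rayCurve`. -/
noncomputable def rayAcceleration (w : ℂ → ℂ) (e : ℂ) (s : ℝ) : ℂ :=
  rayCurve w e s + ((1 / Real.cosh s ^ 3 : ℝ) : ℂ) * (e ^ 2 * deriv (deriv w) (polar e s))

theorem norm_rayCurve (w : ℂ → ℂ) (e : ℂ) (s : ℝ) :
    ‖rayCurve w e s‖ = Real.cosh s * ‖w (polar e s)‖ := by
  rw [rayCurve, norm_mul, Complex.norm_real, Real.norm_of_nonneg (Real.cosh_pos s).le]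

namespace DiskSolution

variable {w : ℂ → ℂ} (hw : DiskSolution w) {e : ℂ} (he : ‖e‖ = 1)

include hw

theorem hasDerivAt {z : ℂ} (hz : z ∈ Metric.ball (0 : ℂ) 1) : HasDerivAt w (deriv w z) z :=
  (hw.differentiableOn.differentiableAt (Metric.isOpen_ball.mem_nhds hz)).hasDerivAt

theorem hasDerivAt_deriv {z : ℂ} (hz : z ∈ Metric.ball (0 : ℂ) 1) :
    HasDerivAt (deriv w) (deriv (deriv w) z) z :=
  ((hw.differentiableOn.deriv Metric.isOpen_ball).differentiableAt
    (Metric.isOpen_ball.mem_nhds hz)).hasDerivAt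

include he

/-- Since `1 - tanh² = 1/cosh²`, the growth condition reads `|w''| ≤ cosh⁴ s · |w|` on the ray;
dividing by `cosh³ s` leaves exactly `|H|`. -/
theorem norm_rayAcceleration_sub_le (s : ℝ) :
    ‖((1 / Real.cosh s ^ 3 : ℝ) : ℂ) * (e ^ 2 * deriv (deriv w) (polar e s))‖
      ≤ ‖rayCurve w e s‖ := by
  have hc := Real.cosh_pos s
  have h := hw.deriv_deriv_le _ (polar_mem he s)
  rw [norm_polar he, sq_abs, Real.one_sub_tanh_sq] at h
  rw [norm_rayCurve, norm_mul, norm_mul, norm_pow, he, one_pow, one_mul, Complex.norm_real,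
    Real.norm_of_nonneg (by positivity)]
  calc _ = Real.cosh s * ((1 / Real.cosh s ^ 2) ^ 2 * ‖deriv (deriv w) (polar e s)‖) := by
        field_simp
    _ ≤ _ := mul_le_mul_of_nonneg_left h hc.le

theorem repelledCurve :
    RepelledCurve (rayCurve w e) (rayVelocity w e) (rayAcceleration w e) where
  hasDerivAt s := by
    have h := ((hw.hasDerivAt (polar_mem he s)).scomp s (hasDerivAt_polar e s))
    have h2 := ((Real.hasDerivAt_cosh s).ofReal_comp).mul h
    refine h2.congr_deriv ?_
    have hc : (Real.cosh s : ℂ) ≠ 0 := by exact_mod_cast (Real.cosh_pos s).ne'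
    simp only [rayVelocity, smul_eq_mul, Function.comp_apply]
    push_cast at hc ⊢
    field_simp
  hasDerivAt_velocity s := by
    have hc' := (Real.cosh_pos s).ne'
    have h := ((hw.hasDerivAt (polar_mem he s)).scomp s (hasDerivAt_polar e s))
    have h' := ((hw.hasDerivAt_deriv (polar_mem he s)).scomp s (hasDerivAt_polar e s))
    have h1 := ((Real.hasDerivAt_sinh s).ofReal_comp).mul h
    have h2 := (((hasDerivAt_const s (1 : ℝ)).div (Real.hasDerivAt_cosh s) hc').ofReal_comp).mul
      (h'.const_mul e)
    refine (h1.add h2).congr_deriv ?_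
    have hc : (Real.cosh s : ℂ) ≠ 0 := by exact_mod_cast hc'
    simp only [rayAcceleration, rayCurve, smul_eq_mul, Function.comp_apply, Pi.div_apply]
    push_cast at hc ⊢
    field_simp
    ring
  norm_initial := by simp [rayCurve, hw.map_zero]
  velocity_zero := by simp [rayVelocity, hw.deriv_zero]
  inner_nonneg s := by
    rw [rayAcceleration, inner_add_right, real_inner_self_eq_norm_sq]
    have h := hw.norm_rayAcceleration_sub_le he s
    have h2 := neg_le_of_abs_le (abs_real_inner_le_norm (rayCurve w e s)
      (((1 / Real.cosh s ^ 3 : ℝ) : ℂ) * (e ^ 2 * deriv (deriv w) (polar e s))))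
    nlinarith [norm_nonneg (rayCurve w e s)]

theorem norm_rayAcceleration_le (s : ℝ) :
    ‖rayAcceleration w e s‖ ≤ 2 * ‖rayCurve w e s‖ := by
  have h := hw.norm_rayAcceleration_sub_le he s
  have := norm_add_le (rayCurve w e s)
    (((1 / Real.cosh s ^ 3 : ℝ) : ℂ) * (e ^ 2 * deriv (deriv w) (polar e s)))
  rw [rayAcceleration]
  linarith

omit he

theorem ne_zero {z : ℂ} (hz : z ∈ Metric.ball (0 : ℂ) 1) : w z ≠ 0 := by
  obtain ⟨e, he, hze⟩ := exists_eq_polar hz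
  intro h0
  have := (hw.repelledCurve he).one_le_norm (Real.artanh_nonneg (norm_nonneg z))
  rw [norm_rayCurve, ← hze, h0] at this
  norm_num at this

theorem norm_sq_le {r : ℝ} (hr : r < 1) {z : ℂ} (hz : ‖z‖ ≤ r) :
    ‖w z‖ ^ 2 ≤ Real.exp (3 * Real.artanh r) := by
  have hz1 : ‖z‖ < 1 := hz.trans_lt hr
  obtain ⟨e, he, hze⟩ := exists_eq_polar (mem_ball_zero_iff.2 hz1)
  have h := (hw.repelledCurve he).norm_sq_le_exp (hw.norm_rayAcceleration_le he)
    (Real.artanh_nonneg (norm_nonneg z))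
  rw [norm_rayCurve, ← hze] at h
  have hle : Real.artanh ‖z‖ ≤ Real.artanh r :=
    Real.artanh_le_artanh (by linarith [norm_nonneg z]) hr hz
  calc ‖w z‖ ^ 2 ≤ (Real.cosh (Real.artanh ‖z‖) * ‖w z‖) ^ 2 := by
        gcongr
        exact le_mul_of_one_le_left (norm_nonneg _) (Real.one_le_cosh _)
    _ ≤ _ := h
    _ ≤ _ := by gcongr

end DiskSolution

/-! ### Growth of the primitive of `1/w²` along a ray -/

/-- `g` is the primitive of `1 / w^2` on the unit disk that vanishes at the origin. -/
structure IsQuotient (g w : ℂ → ℂ) : Prop where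
  hasDerivAt : ∀ z ∈ Metric.ball (0 : ℂ) 1, HasDerivAt g (1 / w z ^ 2) z
  map_zero : g 0 = 0

namespace IsQuotient

variable {g w : ℂ → ℂ} (hg : IsQuotient g w) (hw : DiskSolution w) {e : ℂ} (he : ‖e‖ = 1)

include he

theorem norm_deriv_ray (s : ℝ) : ‖e / rayCurve w e s ^ 2‖ = 1 / ‖rayCurve w e s‖ ^ 2 := by
  rw [norm_div, he, norm_pow]

include hg

theorem hasDerivAt_ray (s : ℝ) :
    HasDerivAt (fun s => g (polar e s)) (e / rayCurve w e s ^ 2) s := by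
  refine ((hg.hasDerivAt _ (polar_mem he s)).scomp s (hasDerivAt_polar e s)).congr_deriv ?_
  simp only [rayCurve, smul_eq_mul]
  push_cast
  rw [mul_pow, div_mul_eq_mul_div, one_mul, div_mul_div_comm, mul_one]

include hw

theorem norm_polar_le {s : ℝ} (hs : 0 ≤ s) : ‖g (polar e s)‖ ≤ s := by
  refine image_norm_le_of_norm_deriv_right_le_deriv_boundary (a := 0) (b := s)
    (f := fun s => g (polar e s)) (B := id) (B' := fun _ => 1)
    (fun t _ => (hg.hasDerivAt_ray he t).continuousAt.continuousWithinAt)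
    (fun t _ => (hg.hasDerivAt_ray he t).hasDerivWithinAt) (by simp [hg.map_zero])
    (fun t => hasDerivAt_id t) (fun t ht => ?_) ⟨hs, le_rfl⟩
  rw [norm_deriv_ray he]
  have := (hw.repelledCurve he).one_le_norm ht.1
  exact div_le_one_of_le₀ (one_le_pow₀ this) (by positivity)

theorem norm_polar_le_of_growth {α s₀ s : ℝ} (hα : 0 < α) (hs₀ : 0 < s₀)
    (h : 1 + α * s₀ ≤ ‖rayCurve w e s₀‖) (hs : 0 ≤ s) : ‖g (polar e s)‖ ≤ s₀ + 1 / α := by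
  rcases le_total s s₀ with hle | hle
  · have := hg.norm_polar_le hw he hs
    have : 0 < 1 / α := by positivity
    linarith
  have hpos : ∀ t, s₀ ≤ t → 0 < 1 + α * t := fun t ht => by
    have := hs₀.trans_le ht
    positivity
  -- A primitive of `(1 + α t)⁻²`, normalized to tend to the claimed bound at infinity and to be at
  -- least `s₀` at `s₀`.
  have hB : ∀ t, s₀ ≤ t → HasDerivAt (fun t => s₀ + 1 / α - 1 / α * (1 + α * t)⁻¹)
      (1 / (1 + α * t) ^ 2) t := by
    intro t ht
    have h1 : HasDerivAt (fun t => 1 + α * t) α t := by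
      simpa using ((hasDerivAt_id t).const_mul α).const_add 1
    have := ((h1.inv (hpos t ht).ne').const_mul (1 / α)).const_sub (s₀ + 1 / α)
    refine this.congr_deriv ?_
    field_simp
  have := image_norm_le_of_norm_deriv_right_le_deriv_boundary' (a := s₀) (b := s)
    (f := fun s => g (polar e s)) (B := fun t => s₀ + 1 / α - 1 / α * (1 + α * t)⁻¹)
    (B' := fun t => 1 / (1 + α * t) ^ 2)
    (fun t _ => (hg.hasDerivAt_ray he t).continuousAt.continuousWithinAt)
    (fun t _ => (hg.hasDerivAt_ray he t).hasDerivWithinAt) ?_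
    (fun t ht => (hB t ht.1).continuousAt.continuousWithinAt)
    (fun t ht => (hB t ht.1).hasDerivWithinAt) (fun t ht => ?_) ⟨hle, le_rfl⟩
  · have h2 : 0 < 1 / α * (1 + α * s)⁻¹ := by have := hpos s hle; positivity
    linarith
  · have h1 := hg.norm_polar_le hw he hs₀.le
    have h2 : (1 + α * s₀)⁻¹ ≤ 1 := inv_le_one_of_one_le₀ (by nlinarith)
    have h3 : 1 / α * (1 + α * s₀)⁻¹ ≤ 1 / α := mul_le_of_le_one_right (by positivity) h2
    linarith
  · rw [norm_deriv_ray he]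
    have h1 := hpos t ht.1
    have h2 := (hw.repelledCurve he).linear_growth hs₀ h ht.1
    gcongr

end IsQuotient

end Nehari

/-! ### From the Nehari class to disk solutions; bounds for `a₂` and `δ` -/

namespace Nehari

theorem exists_log_of_ne_zero {h : ℂ → ℂ} (hd : DifferentiableOn ℂ h (Metric.ball 0 1))
    (h0 : ∀ z ∈ Metric.ball (0 : ℂ) 1, h z ≠ 0) (h1 : h 0 = 1) :
    ∃ l : ℂ → ℂ, l 0 = 0 ∧ ∀ z ∈ Metric.ball (0 : ℂ) 1,
      HasDerivAt l (deriv h z / h z) z ∧ Complex.exp (l z) = h z := by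
  obtain ⟨l, hl0, hl⟩ :=
    (((hd.deriv Metric.isOpen_ball).div hd h0).isExactOn_ball).with_val_at 0 0
  refine ⟨l, hl0, fun z hz => ⟨hl z hz, ?_⟩⟩
  have hder : ∀ z ∈ Metric.ball (0 : ℂ) 1,
      HasDerivAt (fun z => Complex.exp (-l z) * h z) 0 z := by
    intro z hz
    have hh := (hd.differentiableAt (Metric.isOpen_ball.mem_nhds hz)).hasDerivAt
    refine ((hl z hz).neg.cexp.mul hh).congr_deriv ?_
    have := h0 z hz
    simp only [Pi.div_apply]
    field_simp
    ring
  have hconst := (convex_ball (0 : ℂ) 1).norm_image_sub_le_of_norm_hasDerivWithin_le (C := 0)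
    (fun z hz => (hder z hz).hasDerivWithinAt) (by simp)
    (Metric.mem_ball_self one_pos) hz
  rw [zero_mul, norm_le_zero_iff, sub_eq_zero, hl0, h1, Complex.exp_neg, neg_zero,
    Complex.exp_zero, one_mul, inv_mul_eq_one₀ (Complex.exp_ne_zero _)] at hconst
  exact hconst

theorem one_sub_mul_normalized {f : ℂ → ℂ} {z : ℂ} (hz : 1 + a₂ f * f z ≠ 0) :
    1 - a₂ f * normalized f z = (1 + a₂ f * f z)⁻¹ := by
  rw [normalized]
  field_simp
  ring

namespace NehariClass

variable {f : ℂ → ℂ} (hf : NehariClass f)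

include hf

theorem hasDerivAt {z : ℂ} (hz : z ∈ Metric.ball (0 : ℂ) 1) : HasDerivAt f (deriv f z) z :=
  (hf.differentiableOn.differentiableAt (Metric.isOpen_ball.mem_nhds hz)).hasDerivAt

theorem hasDerivAt_deriv {z : ℂ} (hz : z ∈ Metric.ball (0 : ℂ) 1) :
    HasDerivAt (deriv f) (deriv (deriv f) z) z :=
  ((hf.differentiableOn.deriv Metric.isOpen_ball).differentiableAt
    (Metric.isOpen_ball.mem_nhds hz)).hasDerivAt

/-- With `u = (f')^{-1/2}`, both `u` and `u f` solve `y'' + (Sf/2) y = 0`. The combination `u (1 +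
a₂ f)` is the one with zero derivative at 0. -/
theorem exists_diskSolution :
    ∃ w, DiskSolution w ∧
      ∀ z ∈ Metric.ball (0 : ℂ) 1, w z ^ 2 * deriv f z = (1 + a₂ f * f z) ^ 2 := by
  have hd' := hf.differentiableOn.deriv Metric.isOpen_ball
  obtain ⟨l, hl0, hl⟩ := exists_log_of_ne_zero hd' hf.deriv_ne_zero hf.deriv_zero
  set a := a₂ f with ha
  set P : ℂ → ℂ := fun w => deriv (deriv f) w / deriv f w with hP
  set u : ℂ → ℂ := fun z => Complex.exp (-l z / 2) with hu
  set w : ℂ → ℂ := fun z => u z * (1 + a * f z) with hw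
  have h0 : (0 : ℂ) ∈ Metric.ball (0 : ℂ) 1 := Metric.mem_ball_self one_pos
  have hu' : ∀ z ∈ Metric.ball (0 : ℂ) 1, HasDerivAt u (u z * (-P z / 2)) z := fun z hz =>
    ((hl z hz).1.neg.div_const 2).cexp
  have hf' : ∀ z ∈ Metric.ball (0 : ℂ) 1,
      HasDerivAt (fun z => 1 + a * f z) (a * deriv f z) z := fun z hz =>
    ((hf.hasDerivAt hz).const_mul a).const_add 1
  have hw' : ∀ z ∈ Metric.ball (0 : ℂ) 1,
      HasDerivAt w (u z * (-P z / 2 * (1 + a * f z) + a * deriv f z)) z := fun z hz =>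
    ((hu' z hz).mul (hf' z hz)).congr_deriv (by ring)
  have hP' : ∀ z ∈ Metric.ball (0 : ℂ) 1, HasDerivAt P (deriv P z) z := fun z hz =>
    (((hd'.deriv Metric.isOpen_ball).div hd' hf.deriv_ne_zero).differentiableAt
      (Metric.isOpen_ball.mem_nhds hz)).hasDerivAt
  have hw'' : ∀ z ∈ Metric.ball (0 : ℂ) 1,
      deriv (deriv w) z = -(schwarzian f z / 2) * w z := by
    intro z hz
    have hev : deriv w =ᶠ[𝓝 z]
        fun z => u z * (-P z / 2 * (1 + a * f z) + a * deriv f z) := by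
      filter_upwards [Metric.isOpen_ball.mem_nhds hz] with y hy using (hw' y hy).deriv
    rw [hev.deriv_eq]
    have hne := hf.deriv_ne_zero z hz
    have h1 := ((hu' z hz).mul ((((hP' z hz).neg.div_const 2).mul (hf' z hz)).add
      ((hf.hasDerivAt_deriv hz).const_mul a))).deriv
    refine h1.trans ?_
    have hPz : deriv (deriv f) z = P z * deriv f z := by
      simp only [hP]; field_simp
    have hS : schwarzian f z = deriv P z - 1 / 2 * P z ^ 2 := rfl
    simp only [Pi.add_apply, Pi.mul_apply, Pi.neg_apply]
    rw [hPz, hS]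
    simp only [hw]
    ring
  have hu0 : u 0 = 1 := by simp [hu, hl0]
  refine ⟨w, ⟨fun z hz => (hw' z hz).differentiableAt.differentiableWithinAt, ?_, ?_, ?_⟩, ?_⟩
  · simp [hw, hu0, hf.map_zero]
  · rw [(hw' 0 h0).deriv, hu0, hf.map_zero, hf.deriv_zero]
    simp only [hP, hf.deriv_zero, ha, a₂]
    ring
  · intro z hz
    rw [hw'' z hz, norm_mul, norm_neg, norm_div, ← mul_assoc]
    refine mul_le_of_le_one_left (norm_nonneg _) ?_
    have := hf.schwarzian_le z hz
    rw [Complex.norm_ofNat]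
    linarith
  · intro z hz
    have h2 : u z ^ 2 * deriv f z = 1 := by
      rw [← (hl z hz).2, hu]
      simp only
      rw [← Complex.exp_nat_mul, ← Complex.exp_add]
      simp only [Nat.cast_ofNat]
      rw [show 2 * (-l z / 2) + l z = 0 by ring, Complex.exp_zero]
    simp only [hw]
    linear_combination (1 + a * f z) ^ 2 * h2

/-- As `w` and `f'` have no zeros, `w² f' = (1 + a₂ f)²` shows that `f` omits `-1/a₂`. -/
theorem exists_isQuotient :
    ∃ w, DiskSolution w ∧ IsQuotient (normalized f) w ∧
      ∀ z ∈ Metric.ball (0 : ℂ) 1, 1 + a₂ f * f z ≠ 0 := by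
  obtain ⟨w, hw, h⟩ := hf.exists_diskSolution
  have hne : ∀ z ∈ Metric.ball (0 : ℂ) 1, 1 + a₂ f * f z ≠ 0 := by
    intro z hz h0
    have := h z hz
    rw [h0, zero_pow two_ne_zero] at this
    exact mul_ne_zero (pow_ne_zero 2 (hw.ne_zero hz)) (hf.deriv_ne_zero z hz) this
  refine ⟨w, hw, ⟨fun z hz => ?_, by simp [normalized, hf.map_zero]⟩, hne⟩
  have hfz := hf.hasDerivAt hz
  refine (hfz.div ((hfz.const_mul (a₂ f)).const_add 1) (hne z hz)).congr_deriv ?_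
  have h1 := hne z hz
  have h2 := hw.ne_zero hz
  rw [div_eq_div_iff (pow_ne_zero 2 h1) (pow_ne_zero 2 h2), ← h z hz]
  ring

/-- A bound, uniform over the Nehari class, for the second coefficient. -/
theorem norm_a₂_le : ‖a₂ f‖ ≤ 8 / Real.tanh 1 ^ 2 := by
  obtain ⟨w, hw, hg, hne⟩ := hf.exists_isQuotient
  set g := normalized f
  set a := a₂ f
  have h0 : (0 : ℂ) ∈ Metric.ball (0 : ℂ) 1 := Metric.mem_ball_self one_pos
  have hder : ∀ z ∈ Metric.ball (0 : ℂ) 1,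
      HasDerivAt (fun z => 1 - a * g z) (-(a * (1 / w z ^ 2))) z := fun z hz =>
    ((hg.hasDerivAt z hz).const_mul a).const_sub 1
  obtain ⟨l, hl0, hl⟩ := exists_log_of_ne_zero (h := fun z => 1 - a * g z)
    (fun z hz => (hder z hz).differentiableAt.differentiableWithinAt)
    (fun z hz => by
      rw [one_sub_mul_normalized (hne z hz)]
      exact inv_ne_zero (hne z hz)) (by simp [hg.map_zero])
  -- A square root of the zero-free function `1 - a f*`. Cauchy's estimate bounds `|q'(0)| = |a|/2`
  -- by a multiple of `√(1 + |a|)`, which bounds `|a|`.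
  set q : ℂ → ℂ := fun z => Complex.exp (l z / 2) with hq
  have hqd : ∀ z ∈ Metric.ball (0 : ℂ) 1,
      HasDerivAt q (q z * (deriv (fun z => 1 - a * g z) z / (1 - a * g z) / 2)) z := fun z hz =>
    ((hl z hz).1.div_const 2).cexp
  have hqsq : ∀ z ∈ Metric.ball (0 : ℂ) 1, q z ^ 2 = 1 - a * g z := by
    intro z hz
    rw [← (hl z hz).2, hq]
    simp only
    rw [← Complex.exp_nat_mul]
    congr 1
    push_cast
    ring
  have hr : 0 < Real.tanh 1 := by
    rw [Real.tanh_eq_sinh_div_cosh]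
    exact div_pos (Real.sinh_pos_iff.2 one_pos) (Real.cosh_pos 1)
  have hr1 := Real.tanh_lt_one 1
  -- Radius `tanh 1` is arc length 1, where `|f*| ≤ 1`.
  have hbd : ∀ z ∈ Metric.sphere (0 : ℂ) (Real.tanh 1), ‖q z‖ ≤ Real.sqrt (1 + ‖a‖) := by
    intro z hz
    rw [mem_sphere_zero_iff_norm] at hz
    have hzb : z ∈ Metric.ball (0 : ℂ) 1 := mem_ball_zero_iff.2 (hz ▸ hr1)
    obtain ⟨e, he, hze⟩ := exists_eq_polar hzb
    rw [hz, Real.artanh_tanh] at hze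
    have hgz : ‖g z‖ ≤ 1 := hze ▸ hg.norm_polar_le hw he zero_le_one
    refine Real.le_sqrt_of_sq_le ?_
    rw [← norm_pow, hqsq z hzb]
    calc ‖1 - a * g z‖ ≤ ‖(1 : ℂ)‖ + ‖a * g z‖ := norm_sub_le _ _
      _ ≤ 1 + ‖a‖ := by
        rw [norm_one, norm_mul]
        gcongr
        exact mul_le_of_le_one_right (norm_nonneg _) hgz
  have hqdiff : DifferentiableOn ℂ q (Metric.ball 0 1) := fun z hz =>
    (hqd z hz).differentiableAt.differentiableWithinAt
  have hdc : DiffContOnCl ℂ q (Metric.ball 0 (Real.tanh 1)) := by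
    refine (hqdiff.mono ?_).diffContOnCl
    rw [closure_ball _ hr.ne']
    exact Metric.closedBall_subset_ball hr1
  have hc := Complex.norm_deriv_le_of_forall_mem_sphere_norm_le hr hdc hbd
  have hq0 : q 0 = 1 := by simp [hq, hl0]
  rw [(hqd 0 h0).deriv, (hder 0 h0).deriv, hq0, hg.map_zero, hw.map_zero] at hc
  have hc' : ‖a‖ / 2 ≤ Real.sqrt (1 + ‖a‖) / Real.tanh 1 := by simpa using hc
  rw [le_div_iff₀ hr] at hc'
  have hsq : (‖a‖ / 2 * Real.tanh 1) ^ 2 ≤ 1 + ‖a‖ := by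
    rw [← Real.sq_sqrt (by positivity : 0 ≤ 1 + ‖a‖)]
    gcongr
  rw [le_div_iff₀ (by positivity)]
  by_cases h1 : ‖a‖ ≤ 1
  · nlinarith [norm_nonneg a]
  · push Not at h1
    have : ‖a‖ * (‖a‖ * Real.tanh 1 ^ 2) ≤ ‖a‖ * 8 := by nlinarith
    exact le_of_mul_le_mul_left this (by linarith)

end NehariClass

/-- Smallness of `delta` forces the normalized map to take large values. -/
theorem exists_lt_norm_normalized_of_delta_lt {B : ℝ} (hB : 0 ≤ B) :
    ∃ η > 0, ∀ f, NehariClass f → delta f < η →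
      ∃ z ∈ Metric.ball (0 : ℂ) 1, B < ‖normalized f z‖ := by
  obtain ⟨A, hA, hbound⟩ : ∃ A : ℝ, 0 < A ∧ ∀ f, NehariClass f → ‖a₂ f‖ ≤ A := by
    refine ⟨8 / Real.tanh 1 ^ 2, ?_, fun f hf => hf.norm_a₂_le⟩
    have : 0 < Real.tanh 1 := by
      rw [Real.tanh_eq_sinh_div_cosh]
      exact div_pos (Real.sinh_pos_iff.2 one_pos) (Real.cosh_pos 1)
    positivity
  have hη : 0 < Real.pi - 2 * Real.arctan B := by linarith [Real.arctan_lt_pi_div_two B]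
  -- If `|f*| ≤ B` throughout, these bound `δ` from below: the first when `a₂ = 0` (then `f* = f`),
  -- the second when `a₂ ≠ 0`.
  refine ⟨min (Real.pi - 2 * Real.arctan B) (1 / (A * (1 + A * B))), lt_min hη (by positivity),
    fun f hf hδ => ?_⟩
  have : Nonempty (Metric.ball (0 : ℂ) 1) := ⟨⟨0, Metric.mem_ball_self one_pos⟩⟩
  rw [delta] at hδ
  split_ifs at hδ with ha
  · obtain ⟨⟨z, hz⟩, h⟩ := exists_lt_of_ciInf_lt (hδ.trans_le (min_le_left _ _))
    refine ⟨z, hz, ?_⟩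
    rw [normalized, ha, zero_mul, add_zero, div_one]
    simp only [sphericalDistInfty] at h
    exact Real.arctan_lt_arctan_iff.1 (by linarith)
  · obtain ⟨⟨z, hz⟩, h⟩ := exists_lt_of_ciInf_lt (hδ.trans_le (min_le_right _ _))
    refine ⟨z, hz, ?_⟩
    obtain ⟨w, -, -, hne⟩ := hf.exists_isQuotient
    by_contra! hle
    have hn := hne z hz
    have hkey : f z + 1 / a₂ f = 1 / (a₂ f * (1 - a₂ f * normalized f z)) := by
      rw [one_sub_mul_normalized hn]
      field_simp
      ring
    simp only [hkey, norm_div, norm_one] at h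
    have hpos : 0 < ‖a₂ f * (1 - a₂ f * normalized f z)‖ := by
      rw [one_sub_mul_normalized hn, norm_pos_iff]
      exact mul_ne_zero ha (inv_ne_zero hn)
    have hle2 : ‖a₂ f * (1 - a₂ f * normalized f z)‖ ≤ A * (1 + A * B) := by
      rw [norm_mul]
      have h3 : ‖1 - a₂ f * normalized f z‖ ≤ 1 + A * B := by
        refine (norm_sub_le _ _).trans ?_
        rw [norm_one, norm_mul]
        gcongr
        exact hbound f hf
      gcongr
      exact hbound f hf
    exact absurd h (not_lt.2 (one_div_le_one_div_of_le hpos hle2))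

end Nehari

/-! ### Normal families and integration of limits -/

/-- **Montel's theorem** on the unit disk. -/
theorem exists_tendstoLocallyUniformlyOn_of_locally_bounded {F : ℕ → ℂ → ℂ} {M : ℝ → ℝ}
    (hF : ∀ n, DifferentiableOn ℂ (F n) (Metric.ball 0 1))
    (hM : ∀ r, 0 < r → r < 1 → ∀ n z, ‖z‖ ≤ r → ‖F n z‖ ≤ M r) :
    ∃ (φ : ℕ → ℕ) (g : ℂ → ℂ), StrictMono φ ∧
      TendstoLocallyUniformlyOn (fun n => F (φ n)) g atTop (Metric.ball 0 1) := by
  set c : ℕ → ℕ → ℂ := fun n k => (k.factorial : ℂ)⁻¹ * iteratedDeriv k (F n) 0 with hc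
  have hcb : ∀ r, 0 < r → r < 1 → ∀ n k, ‖c n k‖ ≤ M r / r ^ k := by
    intro r hr hr1 n k
    have hdc : DiffContOnCl ℂ (F n) (Metric.ball 0 r) := by
      refine ((hF n).mono ?_).diffContOnCl
      rw [closure_ball _ hr.ne']
      exact Metric.closedBall_subset_ball hr1
    have h := Complex.norm_iteratedDeriv_le_of_forall_mem_sphere_norm_le k hr hdc
      fun z hz => hM r hr hr1 n z (mem_sphere_zero_iff_norm.1 hz).le
    have hk : (0 : ℝ) < k.factorial := by exact_mod_cast k.factorial_pos
    rw [hc]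
    simp only
    rw [norm_mul, norm_inv, Complex.norm_natCast, inv_mul_le_iff₀ hk]
    calc _ ≤ _ := h
      _ = _ := by ring
  -- By Cauchy's estimates the Taylor coefficient sequences lie in a product of compact disks;
  -- compactness of the product replaces a diagonal argument.
  obtain ⟨a, -, φ, hφ, ha⟩ := (isCompact_univ_pi fun k : ℕ =>
    isCompact_closedBall (0 : ℂ) (M (1 / 2) / (1 / 2) ^ k)).tendsto_subseq (x := c)
    fun n k _ => mem_closedBall_zero_iff.2 (hcb _ (by norm_num) (by norm_num) n k)
  rw [tendsto_pi_nhds] at ha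
  have hab : ∀ r, 0 < r → r < 1 → ∀ k, ‖a k‖ ≤ M r / r ^ k := fun r hr hr1 k =>
    le_of_tendsto (ha k).norm (Eventually.of_forall fun n => hcb r hr hr1 _ k)
  refine ⟨φ, fun z => ∑' k, a k * z ^ k, hφ, ?_⟩
  rw [Metric.tendstoLocallyUniformlyOn_iff]
  intro ε hε x hx
  rw [mem_ball_zero_iff] at hx
  obtain ⟨r, hxr, hr1⟩ := exists_between hx
  obtain ⟨ρ, hrρ, hρ1⟩ := exists_between hr1
  have hr0 : 0 < r := (norm_nonneg x).trans_lt hxr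
  have hρ0 : 0 < ρ := hr0.trans hrρ
  have hgeom : Summable fun k : ℕ => M ρ * (r / ρ) ^ k :=
    (summable_geometric_of_lt_one (by positivity) ((div_lt_one hρ0).2 hrρ)).mul_left _
  have hterm : ∀ b : ℂ, ∀ k, ‖b‖ ≤ M ρ / ρ ^ k → ‖b‖ * r ^ k ≤ M ρ * (r / ρ) ^ k := by
    intro b k hb
    calc ‖b‖ * r ^ k ≤ M ρ / ρ ^ k * r ^ k := by gcongr
      _ = _ := by rw [div_pow]; ring
  have hbd : ∀ n k, ‖c (φ n) k - a k‖ * r ^ k ≤ 2 * (M ρ * (r / ρ) ^ k) := by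
    intro n k
    have h1 := hterm _ k (hcb ρ hρ0 hρ1 (φ n) k)
    have h2 := hterm _ k (hab ρ hρ0 hρ1 k)
    have h3 := mul_le_mul_of_nonneg_right (norm_sub_le (c (φ n) k) (a k)) (pow_nonneg hr0.le k)
    linarith
  -- Dominated convergence, with a geometric majorant because `r < ρ`.
  have hT : Tendsto (fun n => ∑' k, ‖c (φ n) k - a k‖ * r ^ k) atTop (𝓝 0) := by
    have h := tendsto_tsum_of_dominated_convergence (𝓕 := atTop)
      (f := fun n k => ‖c (φ n) k - a k‖ * r ^ k) (g := fun _ => (0 : ℝ)) (hgeom.mul_left 2)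
      (fun k => ?_) (Eventually.of_forall fun n k => ?_)
    · simpa using h
    · have := (((ha k).sub_const (a k)).norm).mul_const (r ^ k)
      simpa using this
    · rw [Real.norm_of_nonneg (by positivity)]
      exact hbd n k
  refine ⟨Metric.closedBall 0 r, mem_nhdsWithin_of_mem_nhds
    (mem_of_superset (Metric.isOpen_ball.mem_nhds (mem_ball_zero_iff.2 hxr))
      Metric.ball_subset_closedBall), ?_⟩
  filter_upwards [hT.eventually_lt_const hε] with n hn y hy
  rw [mem_closedBall_zero_iff] at hy
  have hyb : y ∈ Metric.ball (0 : ℂ) 1 := mem_ball_zero_iff.2 (hy.trans_lt hr1)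
  have hsF : HasSum (fun k => c (φ n) k * y ^ k) (F (φ n) y) := by
    refine (Complex.hasSum_taylorSeries_on_ball (hF (φ n)) hyb).congr_fun ?_
    intro k
    simp only [hc, smul_eq_mul, sub_zero]
    ring
  have hle : ∀ b : ℂ, ∀ k, ‖b * y ^ k‖ ≤ ‖b‖ * r ^ k := fun b k => by
    rw [norm_mul, norm_pow]
    gcongr
  have hsa : Summable fun k => a k * y ^ k :=
    hgeom.of_norm_bounded fun k => (hle _ k).trans (hterm _ k (hab ρ hρ0 hρ1 k))
  have hsd := hsF.sub hsa.hasSum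
  rw [dist_comm, dist_eq_norm, ← hsd.tsum_eq]
  have hsT : Summable fun k => ‖c (φ n) k - a k‖ * r ^ k :=
    (hgeom.mul_left 2).of_nonneg_of_le (fun k => by positivity) (hbd n)
  refine (tsum_of_norm_bounded hsT.hasSum fun k => ?_).trans_lt hn
  rw [← sub_mul]
  exact hle _ k

/-- Primitives on the unit disk that agree at the origin converge locally uniformly if their
derivatives do. -/
theorem TendstoLocallyUniformlyOn.of_hasDerivAt {G D : ℕ → ℂ → ℂ} {g d : ℂ → ℂ}
    (hG : ∀ n, ∀ z ∈ Metric.ball (0 : ℂ) 1, HasDerivAt (G n) (D n z) z)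
    (hg : ∀ z ∈ Metric.ball (0 : ℂ) 1, HasDerivAt g (d z) z) (h0 : ∀ n, G n 0 = g 0)
    (h : TendstoLocallyUniformlyOn D d atTop (Metric.ball 0 1)) :
    TendstoLocallyUniformlyOn G g atTop (Metric.ball 0 1) := by
  rw [Metric.tendstoLocallyUniformlyOn_iff]
  intro ε hε x hx
  rw [mem_ball_zero_iff] at hx
  obtain ⟨r, hxr, hr1⟩ := exists_between hx
  have hsub : Metric.closedBall (0 : ℂ) r ⊆ Metric.ball 0 1 := Metric.closedBall_subset_ball hr1
  have hr0 : 0 ≤ r := (norm_nonneg x).trans hxr.le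
  have hu := (tendstoLocallyUniformlyOn_iff_forall_isCompact Metric.isOpen_ball).1 h _ hsub
    (isCompact_closedBall 0 r)
  refine ⟨Metric.closedBall 0 r, mem_nhdsWithin_of_mem_nhds
    (mem_of_superset (Metric.isOpen_ball.mem_nhds (mem_ball_zero_iff.2 hxr))
      Metric.ball_subset_closedBall), ?_⟩
  filter_upwards [Metric.tendstoUniformlyOn_iff.1 hu (ε / 2) (half_pos hε)] with n hn y hy
  have := (convex_closedBall (0 : ℂ) r).norm_image_sub_le_of_norm_hasDerivWithin_le
    (f := fun z => g z - G n z) (f' := fun z => d z - D n z) (C := ε / 2)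
    (fun z hz => ((hg z (hsub hz)).sub (hG n z (hsub hz))).hasDerivWithinAt)
    (fun z hz => by rw [← dist_eq_norm]; exact (hn z hz).le)
    (Metric.mem_closedBall_self hr0) hy
  rw [h0, sub_self, sub_zero, sub_zero] at this
  rw [dist_eq_norm]
  have hy1 := mem_closedBall_zero_iff.1 hy
  nlinarith [norm_nonneg y]

/-! ### Limits of disk solutions and the strip map -/

namespace Nehari

theorem hasDerivAt_stripMap {z : ℂ} (hz : ‖z‖ < 1) :
    HasDerivAt stripMap (1 / (1 - z ^ 2)) z := by
  have h1 : 1 - z ≠ 0 := by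
    intro h
    rw [sub_eq_zero] at h
    simp [← h] at hz
  have h2 : 1 + z ≠ 0 := Complex.slitPlane_ne_zero (Complex.mem_slitPlane_of_norm_lt_one hz)
  have hre : 0 < ((1 + z) / (1 - z)).re := by
    have hn : 0 < Complex.normSq (1 - z) := Complex.normSq_pos.2 h1
    rw [Complex.div_re, ← add_div]
    refine div_pos ?_ hn
    have hsq : z.re * z.re + z.im * z.im < 1 := by
      rw [← Complex.normSq_apply, Complex.normSq_eq_norm_sq]
      exact pow_lt_one₀ (norm_nonneg z) hz two_ne_zero
    simp only [Complex.add_re, Complex.sub_re, Complex.one_re, Complex.add_im, Complex.sub_im,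
      Complex.one_im]
    nlinarith
  have hq := ((hasDerivAt_id z).const_add 1).div ((hasDerivAt_id z).const_sub 1) h1
  refine ((hq.clog (Or.inl hre)).const_mul (1 / 2)).congr_deriv ?_
  have h3 : 1 - z ^ 2 ≠ 0 := by
    rw [show 1 - z ^ 2 = (1 + z) * (1 - z) by ring]
    exact mul_ne_zero h2 h1
  simp only [Pi.div_apply, id]
  field_simp
  ring

theorem DiskSolution.of_tendsto {F : ℕ → ℂ → ℂ} {w : ℂ → ℂ} (hF : ∀ n, DiskSolution (F n))
    (h : TendstoLocallyUniformlyOn F w atTop (Metric.ball 0 1)) : DiskSolution w := by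
  have hev : ∀ᶠ n in atTop, DifferentiableOn ℂ (F n) (Metric.ball 0 1) :=
    Eventually.of_forall fun n => (hF n).differentiableOn
  have h' := h.deriv hev Metric.isOpen_ball
  have h'' := h'.deriv (hev.mono fun n hn => hn.deriv Metric.isOpen_ball) Metric.isOpen_ball
  have h0 : (0 : ℂ) ∈ Metric.ball (0 : ℂ) 1 := Metric.mem_ball_self one_pos
  refine ⟨h.differentiableOn hev Metric.isOpen_ball, ?_, ?_, fun z hz => ?_⟩
  · exact tendsto_nhds_unique (h.tendsto_at h0)
      (by simpa only [(hF _).map_zero] using tendsto_const_nhds)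
  · exact tendsto_nhds_unique (h'.tendsto_at h0)
      (by simpa only [Function.comp_apply, (hF _).deriv_zero] using tendsto_const_nhds)
  · exact le_of_tendsto_of_tendsto' ((h''.tendsto_at hz).norm.const_mul _)
      (h.tendsto_at hz).norm fun n => (hF n).deriv_deriv_le z hz

/-- If the norm exceeded 1 at `s`, one slope `α` would serve all late `n`, bounding `g n` on its ray
by `s + 1/α`. -/
theorem DiskSolution.norm_rayCurve_eq_one_of_unbounded {F g : ℕ → ℂ → ℂ} {w : ℂ → ℂ}
    (hF : ∀ n, DiskSolution (F n)) (hg : ∀ n, IsQuotient (g n) (F n))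
    (h : TendstoLocallyUniformlyOn F w atTop (Metric.ball 0 1)) {e : ℕ → ℂ} {e₀ : ℂ}
    (he : ∀ n, ‖e n‖ = 1) (he₀ : ‖e₀‖ = 1) (hlim : Tendsto e atTop (𝓝 e₀)) {t : ℕ → ℝ}
    (ht : ∀ n, 0 ≤ t n) (hunb : Tendsto (fun n => ‖g n (polar (e n) (t n))‖) atTop atTop)
    {s : ℝ} (hs : 0 < s) : ‖rayCurve w e₀ s‖ = 1 := by
  have hw := DiskSolution.of_tendsto hF h
  refine ((hw.repelledCurve he₀).one_le_norm hs.le).antisymm' ?_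
  by_contra! hlt
  obtain ⟨α, hα, hαs⟩ : ∃ α > 0, 1 + α * s < ‖rayCurve w e₀ s‖ := by
    refine ⟨(‖rayCurve w e₀ s‖ - 1) / (2 * s), div_pos (by linarith) (by positivity), ?_⟩
    have : (‖rayCurve w e₀ s‖ - 1) / (2 * s) * s = (‖rayCurve w e₀ s‖ - 1) / 2 := by
      field_simp
    linarith
  have hpol : Tendsto (fun n => polar (e n) s) atTop
      (𝓝[Metric.ball (0 : ℂ) 1] (polar e₀ s)) :=
    tendsto_nhdsWithin_iff.2 ⟨hlim.const_mul _, Eventually.of_forall fun n => polar_mem (he n) s⟩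
  have hray : Tendsto (fun n => ‖rayCurve (F n) (e n) s‖) atTop (𝓝 ‖rayCurve w e₀ s‖) :=
    ((h.tendsto_comp (hw.differentiableOn.continuousOn _ (polar_mem he₀ s))
      (polar_mem he₀ s) hpol).const_mul _).norm
  obtain ⟨n, hn1, hn2⟩ := ((hray.eventually_const_lt hαs).and
    (hunb.eventually_gt_atTop (s + 1 / α))).exists
  exact hn2.not_ge ((hg n).norm_polar_le_of_growth (hF n) (he n) hα hs hn1.le (ht n))

/-- The ray curve is constantly 1, so `w = 1/cosh s` on the ray, and the identity theorem extends
the formula. Squaring avoids a branch of the root. -/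
theorem DiskSolution.sq_eq_of_norm_rayCurve_eq_one {w : ℂ → ℂ} (hw : DiskSolution w) {e : ℂ}
    (he : ‖e‖ = 1) (h : ∀ s, 0 < s → ‖rayCurve w e s‖ = 1) :
    ∀ z ∈ Metric.ball (0 : ℂ) 1, w z ^ 2 = 1 - (e⁻¹ * z) ^ 2 := by
  have hen : e ≠ 0 := by
    intro h0
    simp [h0] at he
  have hray : ∀ s, 0 < s → w (polar e s) ^ 2 = 1 - (e⁻¹ * polar e s) ^ 2 := by
    intro s hs
    have h1 := (hw.repelledCurve he).eq_of_norm_eq_one h hs.le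
    have h0 : rayCurve w e 0 = 1 := by simp [rayCurve, hw.map_zero]
    rw [h0, rayCurve] at h1
    have hc : (Real.cosh s : ℂ) ≠ 0 := by exact_mod_cast (Real.cosh_pos s).ne'
    have h2 : e⁻¹ * polar e s = Real.tanh s := by
      rw [polar]
      field_simp
    have h3 : (1 : ℂ) - (Real.tanh s : ℂ) ^ 2 = 1 / (Real.cosh s : ℂ) ^ 2 := by
      exact_mod_cast Real.one_sub_tanh_sq s
    rw [h2, h3, eq_div_iff (pow_ne_zero 2 hc), ← mul_pow, mul_comm, h1, one_pow]
  have h0 : (0 : ℂ) ∈ Metric.ball (0 : ℂ) 1 := Metric.mem_ball_self one_pos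
  refine AnalyticOnNhd.eqOn_of_preconnected_of_frequently_eq (f := fun z => w z ^ 2)
    (g := fun z => 1 - (e⁻¹ * z) ^ 2)
    ((hw.differentiableOn.pow 2).analyticOnNhd Metric.isOpen_ball)
    (DifferentiableOn.analyticOnNhd (by fun_prop) Metric.isOpen_ball)
    (convex_ball (0 : ℂ) 1).isPreconnected h0 ?_
  have hseq : Tendsto (fun n : ℕ => polar e (1 / ((n : ℝ) + 1))) atTop (𝓝[≠] 0) := by
    refine tendsto_nhdsWithin_iff.2 ⟨?_, Eventually.of_forall fun n => ?_⟩
    · have := (hasDerivAt_polar e 0).continuousAt.tendsto.comp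
        (tendsto_one_div_add_atTop_nhds_zero_nat (𝕜 := ℝ))
      simpa [Function.comp_def] using this
    · have hpos : (0 : ℝ) < 1 / ((n : ℝ) + 1) := by positivity
      have htanh : Real.tanh (1 / ((n : ℝ) + 1)) ≠ 0 := by
        rw [Real.tanh_eq_sinh_div_cosh]
        exact (div_pos (Real.sinh_pos_iff.2 hpos) (Real.cosh_pos _)).ne'
      exact mul_ne_zero (by exact_mod_cast htanh) hen
  exact hseq.frequently (Eventually.of_forall fun n => hray _ (by positivity)).frequently

end Nehari

/-! ### Extraction of the subsequence -/

open Nehari in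
theorem lemma3p2 (f : ℕ → ℂ → ℂ) (hf : ∀ n, Nehari.NehariClass (f n))
    (hδ : Tendsto (fun n => Nehari.delta (f n)) atTop (𝓝 0)) :
    ∃ (φ : ℕ → ℕ) (c : ℂ), StrictMono φ ∧ ‖c‖ = 1 ∧
      TendstoLocallyUniformlyOn (fun k => Nehari.normalized (f (φ k)))
        (fun z => c⁻¹ * Nehari.stripMap (c * z)) atTop (Metric.ball (0 : ℂ) 1) := by
  obtain ⟨φ₁, hφ₁, hlarge⟩ : ∃ φ : ℕ → ℕ, StrictMono φ ∧ ∀ k : ℕ,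
      ∃ z ∈ Metric.ball (0 : ℂ) 1, (k : ℝ) < ‖normalized (f (φ k)) z‖ := by
    refine extraction_forall_of_eventually (P := fun k n =>
      ∃ z ∈ Metric.ball (0 : ℂ) 1, (k : ℝ) < ‖normalized (f n) z‖) fun k => ?_
    obtain ⟨η, hη, h⟩ := exists_lt_norm_normalized_of_delta_lt (Nat.cast_nonneg (α := ℝ) k)
    filter_upwards [hδ.eventually_lt_const hη] with n hn using h _ (hf n) hn
  choose z hz hzk using hlarge
  choose w hw hg _ using fun k => (hf (φ₁ k)).exists_isQuotient
  choose e he hze using fun k => exists_eq_polar (hz k)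
  obtain ⟨φ₂, w₀, hφ₂, hlim⟩ := exists_tendstoLocallyUniformlyOn_of_locally_bounded (F := w)
    (M := fun r => Real.sqrt (Real.exp (3 * Real.artanh r))) (fun n => (hw n).differentiableOn)
    fun r _ hr1 n z hzr => Real.le_sqrt_of_sq_le ((hw n).norm_sq_le hr1 hzr)
  obtain ⟨e₀, he₀, φ₃, hφ₃, helim⟩ := (isCompact_sphere (0 : ℂ) 1).tendsto_subseq
    (x := fun n => e (φ₂ n)) fun n => mem_sphere_zero_iff_norm.2 (he _)
  rw [mem_sphere_zero_iff_norm] at he₀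
  have hφ : StrictMono (φ₂ ∘ φ₃) := hφ₂.comp hφ₃
  have hlim' : TendstoLocallyUniformlyOn (fun n => w (φ₂ (φ₃ n))) w₀ atTop (Metric.ball 0 1) :=
    fun u hu x hx => (hlim u hu x hx).imp fun _ ht => ⟨ht.1, hφ₃.tendsto_atTop.eventually ht.2⟩
  have hw₀ := DiskSolution.of_tendsto (fun n => hw (φ₂ (φ₃ n))) hlim'
  have hunb : Tendsto (fun n => ‖normalized (f (φ₁ (φ₂ (φ₃ n))))
      (polar (e (φ₂ (φ₃ n))) (Real.artanh ‖z (φ₂ (φ₃ n))‖))‖) atTop atTop := by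
    refine tendsto_atTop_mono (fun n => ?_) tendsto_natCast_atTop_atTop
    rw [← hze]
    exact (Nat.cast_le.2 (hφ.id_le n)).trans (hzk _).le
  have hsq := hw₀.sq_eq_of_norm_rayCurve_eq_one he₀ fun s hs =>
    DiskSolution.norm_rayCurve_eq_one_of_unbounded (fun n => hw (φ₂ (φ₃ n)))
      (fun n => hg (φ₂ (φ₃ n))) hlim' (fun n => he _) he₀ helim
      (fun n => Real.artanh_nonneg (norm_nonneg _)) hunb hs
  have hc : ‖e₀⁻¹‖ = 1 := by rw [norm_inv, he₀, inv_one]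
  have hc0 : e₀⁻¹ ≠ 0 := norm_ne_zero_iff.1 (hc ▸ one_ne_zero)
  -- The rotation `c` is the inverse of the limit direction, along which `c z` is real.
  refine ⟨fun k => φ₁ (φ₂ (φ₃ k)), e₀⁻¹, hφ₁.comp hφ, hc, ?_⟩
  refine TendstoLocallyUniformlyOn.of_hasDerivAt (fun n => (hg (φ₂ (φ₃ n))).hasDerivAt)
    (d := fun z => 1 / w₀ z ^ 2) (fun x hx => ?_) (fun n => ?_) ?_
  · have hx1 : ‖e₀⁻¹ * x‖ < 1 := by rw [norm_mul, hc, one_mul]; exact mem_ball_zero_iff.1 hx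
    have hlin : HasDerivAt (fun z => e₀⁻¹ * z) e₀⁻¹ x := by
      simpa using (hasDerivAt_id x).const_mul e₀⁻¹
    refine (((hasDerivAt_stripMap hx1).comp x hlin).const_mul (e₀⁻¹)⁻¹).congr_deriv ?_
    rw [hsq x hx, mul_comm (1 / _), inv_mul_cancel_left₀ hc0]
  · rw [(hg _).map_zero]
    simp [stripMap]
  · have hcont := hw₀.differentiableOn.continuousOn
    have hmul := hlim'.mul₀ hlim' hcont hcont
    have hinv := hmul.inv₀ (hcont.mul hcont)
      fun x hx => mul_ne_zero (hw₀.ne_zero hx) (hw₀.ne_zero hx)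
    refine (hinv.congr fun n x _ => ?_).congr_right fun x _ => ?_
    · simp [sq]
    · simp [sq]
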